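/- Let $d\in\{1,2,3\}$ and let $D\subseteq\mathbb{R}^d$ be open, bounded and of class $S$, i.e. there are $\gamma\in(0,1)$ and $r_0>0$ such that $\operatorname{meas}(B_r(x)\setminus D)\ge\gamma\operatorname{meas}(B_r(x))$ for all $x\in\partial D$ and all $0<r<r_0$. Let $m\in\mathbb{N}$, $f_0,\phi_1,\dots,\phi_m\in L^2(D)$, $f(x,z):=f_0(x)+\sum_{i=1}^m z_i\phi_i(x)$ for $z\in\mathbb{R}^m$, let $F\colon L^2(D)\to\mathbb{R}$ be convex and Fréchet differentiable, $\alpha\in\mathbb{R}$ and $p\in(0,1]$. Let $\xi$ be an $m$-dimensional random vector on a probability space $(\Omega,\mathcal{F},\mathbb{P})$, and consider the problem $$\min_{u\in L^2(D)}F(u)\quad\text{s.t.}\quad \mathbb{P}\bigl(y(x,\omega)\le\alpha\ \ \forall x\in D\bigr)\ge p,$$ where the random state $y$ satisfies, for $\mathbb{P}$-almost every $\omega$, $$-\Delta y(\cdot,\omega)=u+f(\cdot,\xi(\omega))\ \text{ in } D,\qquad y(\cdot,\omega)=0\ \text{ on }\partial D,$$ that is, $y(\cdot,\omega)\in H^1_0(D)\cap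 C(\bar D)$ is the weak solution of this boundary value problem. Assume that either (a) $\xi$ has a Gaussian distribution $\mathcal{N}(\mu,\Sigma)$ with $\mu\in\mathbb{R}^m$ and $\Sigma$ symmetric positive semidefinite, or (b) $\xi$ has such a Gaussian distribution truncated to (i.e. conditioned on) a set $\Xi=\{z\in\mathbb{R}^m\mid s(z)\le 0\}$ of positive $\mathcal{N}(\mu,\Sigma)$-measure, where $s\colon\mathbb{R}^m\to\mathbb{R}$ is convex. Then this optimization problem is convex, i.e. its objective $F$ is convex and its feasible set (the set of all $u\in L^2(D)$ satisfying the probabilistic constraint) is a convex subset of $L^2(D)$. -/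

import Mathlib

open MeasureTheory ProbabilityTheory Filter Topology Set
open scoped Gradient

/-- A set `D` is of class `S`: near every boundary point, the complement of `D` fills at least a
fixed fraction of every small ball. -/
def IsClassS {d : ℕ} (D : Set (EuclideanSpace ℝ (Fin d))) : Prop :=
  ∃ γ ∈ Ioo (0 : ℝ) 1, ∃ r₀ > (0 : ℝ), ∀ x ∈ frontier D, ∀ r ∈ Ioo (0 : ℝ) r₀,
    ENNReal.ofReal γ * volume (Metric.ball x r) ≤ volume (Metric.ball x r \ D)

/-- The control space `L²(D)`. -/
abbrev L2 {d : ℕ} (D : Set (EuclideanSpace ℝ (Fin d))) : Type :=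
  Lp ℝ 2 ((volume : Measure (EuclideanSpace ℝ (Fin d))).restrict D)

/-- Test functions `φ ∈ C_c^∞(D)`, extended by zero to the whole space. -/
structure IsTestFunction {d : ℕ} (D : Set (EuclideanSpace ℝ (Fin d)))
    (φ : EuclideanSpace ℝ (Fin d) → ℝ) : Prop where
  contDiff : ContDiff ℝ (⊤ : ℕ∞) φ
  hasCompactSupport : HasCompactSupport φ
  tsupport_subset : tsupport φ ⊆ D

/-- `y ∈ H₀¹(D)` with weak gradient `G`: the pair `(y, G)` is the limit in `L²(D) × L²(D)^d` of
pairs `(φ n, ∇ φ n)` with `φ n ∈ C_c^∞(D)`. -/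
structure HasH10Gradient {d : ℕ} (D : Set (EuclideanSpace ℝ (Fin d)))
    (y : EuclideanSpace ℝ (Fin d) → ℝ)
    (G : EuclideanSpace ℝ (Fin d) → EuclideanSpace ℝ (Fin d)) : Prop where
  memLp : MemLp y 2 (volume.restrict D)
  memLp_gradient : MemLp G 2 (volume.restrict D)
  exists_approx : ∃ φ : ℕ → EuclideanSpace ℝ (Fin d) → ℝ, (∀ n, IsTestFunction D (φ n)) ∧
    Tendsto (fun n => eLpNorm (fun x => φ n x - y x) 2 (volume.restrict D)) atTop (𝓝 0) ∧
    Tendsto (fun n => eLpNorm (fun x => ∇ (φ n) x - G x) 2 (volume.restrict D)) atTop (𝓝 0)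

/-- `y` is the solution in `H₀¹(D) ∩ C(closure D)` of `-Δ y = r` in `D`, `y = 0` on the boundary;
the equation is understood in the weak sense. Only the values of `y` on `closure D` matter. -/
structure IsPoissonSolution {d : ℕ} (D : Set (EuclideanSpace ℝ (Fin d)))
    (r : L2 D) (y : EuclideanSpace ℝ (Fin d) → ℝ) : Prop where
  continuousOn : ContinuousOn y (closure D)
  eq_zero_of_mem_frontier : ∀ x ∈ frontier D, y x = 0
  weak_eq : ∃ G : EuclideanSpace ℝ (Fin d) → EuclideanSpace ℝ (Fin d), HasH10Gradient D y G ∧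
    ∀ φ : EuclideanSpace ℝ (Fin d) → ℝ, IsTestFunction D φ →
      ∫ x in D, inner ℝ (G x) (∇ φ x) = ∫ x in D, r x * φ x

/-- The source term `f(·, z) = f₀ + ∑ i, z i φ i`. -/
noncomputable def sourceTerm {d m : ℕ} {D : Set (EuclideanSpace ℝ (Fin d))}
    (f₀ : L2 D) (φ : Fin m → L2 D) (z : EuclideanSpace ℝ (Fin m)) : L2 D :=
  f₀ + ∑ i, z i • φ i

/-- The feasible controls: those `u` for which the random state `y`, that is, the (almost surely
unique) random function with `-Δ y(·, ω) = u + f(·, ξ ω)` in `D`, `y(·, ω) = 0` on the boundary,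
almost surely, satisfies `ℙ (y(x, ω) ≤ α for all x ∈ D) ≥ p`. -/
def feasibleSet {d m : ℕ} (D : Set (EuclideanSpace ℝ (Fin d)))
    (f₀ : L2 D) (φ : Fin m → L2 D) (α p : ℝ)
    {Ω : Type*} [MeasurableSpace Ω] (P : Measure Ω) (ξ : Ω → EuclideanSpace ℝ (Fin m)) :
    Set (L2 D) :=
  {u | ∃ y : Ω → EuclideanSpace ℝ (Fin d) → ℝ,
    (∀ᵐ ω ∂P, IsPoissonSolution D (u + sourceTerm f₀ φ (ξ ω)) (y ω)) ∧
    p ≤ P.real {ω | ∀ x ∈ D, y ω x ≤ α}}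

/-- The problem of minimizing `F` over the feasible set `C` is convex: the objective is a convex
function and the feasible set is convex. -/
def IsConvexProblem {V : Type*} [AddCommGroup V] [Module ℝ V] (F : V → ℝ) (C : Set V) : Prop :=
  ConvexOn ℝ univ F ∧ Convex ℝ C

/-- The Gaussian distribution `N(μ, S)` truncated to `Ξ`, i.e. conditioned on `Ξ`. (It is a
probability measure exactly if `Ξ` has positive Gaussian measure, and zero otherwise.) -/
noncomputable def truncatedGaussian {m : ℕ} (μ : EuclideanSpace ℝ (Fin m))
    (S : Matrix (Fin m) (Fin m) ℝ) (Ξ : Set (EuclideanSpace ℝ (Fin m))) :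
    Measure (EuclideanSpace ℝ (Fin m)) :=
  ProbabilityTheory.cond (multivariateGaussian μ S) Ξ

/-! ### The Prékopa–Leindler inequality, from the line to Gaussian measures. -/

section PrekopaLeindler

open scoped ENNReal

/-! Call `z` safe for `u` if some solution with source `u + f(·, z)` stays below `α` on `D`. The
Poisson problem is linear and the source is affine in `z`, so the pairs `(u, z)` with `z` safe for
`u` form a convex set (`smul_add_smul_mem_safeOutcomes`). It remains to see that the law of `ξ` is
log-concave: if `u₁`, `u₂` are safe with probability at least `p`, then `a • u₁ + b • u₂` is safe
with probability at least `p ^ a * p ^ b = p`.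

Log-concavity comes from Prékopa–Leindler, which passes from Lebesgue measure on the line to
log-concave densities, products and affine images, hence to all Gaussians, degenerate ones included.
Truncation to a convex set only intersects the events with that set. Safe sets are known to be
convex but not Borel, hence the null-measurability of convex sets in `Convex.nullMeasurableSet_map`.
-/

/-- The conclusion of the Prékopa–Leindler inequality, as a property of a measure. -/
def SatisfiesPrekopaLeindler {E : Type*} [AddCommGroup E] [Module ℝ E] [MeasurableSpace E]
    (μ : Measure E) : Prop :=
  ∀ ⦃a b : ℝ⦄, 0 < a → 0 < b → a + b = 1 → ∀ ⦃f g h : E → ℝ≥0∞⦄,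
    Measurable f → Measurable g → Measurable h →
    (∀ x y, f x ^ a * g y ^ b ≤ h (a • x + b • y)) →
    (∫⁻ x, f x ∂μ) ^ a * (∫⁻ x, g x ∂μ) ^ b ≤ ∫⁻ x, h x ∂μ

theorem ENNReal.rpow_mul_rpow_le_add {a b : ℝ} (ha : 0 < a) (hb : 0 < b) (hab : a + b = 1)
    (x y : ℝ≥0∞) : x ^ a * y ^ b ≤ ENNReal.ofReal a * x + ENNReal.ofReal b * y := by
  have hpq : (a⁻¹).HolderConjugate b⁻¹ := by
    rw [Real.holderConjugate_iff]
    refine ⟨(one_lt_inv₀ ha).2 (by linarith), by simpa using hab⟩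
  have key := ENNReal.young_inequality (x ^ a) (y ^ b) hpq
  rw [← ENNReal.rpow_mul, ← ENNReal.rpow_mul, mul_inv_cancel₀ ha.ne', mul_inv_cancel₀ hb.ne',
    ENNReal.rpow_one, ENNReal.rpow_one, ENNReal.ofReal_inv_of_pos ha,
    ENNReal.ofReal_inv_of_pos hb, div_eq_mul_inv, div_eq_mul_inv, inv_inv, inv_inv] at key
  simpa [mul_comm] using key

open scoped Pointwise in
theorem volume_image_mul_add {a : ℝ} (ha : 0 < a) (c : ℝ) (s : Set ℝ) :
    volume ((fun x => a * x + c) '' s) = ENNReal.ofReal a * volume s := by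
  have : (fun x => a * x + c) '' s = (fun x => x + c) '' (a • s) := by
    rw [← image_smul, image_image]
    rfl
  rw [this, image_add_right, measure_preimage_add_right, Measure.addHaar_smul]
  simp [abs_of_pos ha]

/-- The Brunn–Minkowski inequality on the line, for compact sets. -/
theorem IsCompact.volume_add_volume_le {a b : ℝ} (ha : 0 < a) (hb : 0 < b) {A B C : Set ℝ}
    (hA : IsCompact A) (hB : IsCompact B) (hA' : A.Nonempty) (hB' : B.Nonempty)
    (h : ∀ x ∈ A, ∀ y ∈ B, a * x + b * y ∈ C) :
    ENNReal.ofReal a * volume A + ENNReal.ofReal b * volume B ≤ volume C := by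
  obtain ⟨x₁, hx₁, hx₁'⟩ := hA.exists_isGreatest hA'
  obtain ⟨y₀, hy₀, hy₀'⟩ := hB.exists_isLeast hB'
  -- With `x₁ = max A` and `y₀ = min B`, these two translates lie in `C` and meet at most at `a * x₁
  -- + b * y₀`.
  set A' := (fun x => a * x + b * y₀) '' A
  set B' := (fun y => b * y + a * x₁) '' B
  have hmB : MeasurableSet B' := (hB.image (by fun_prop)).measurableSet
  have hdisj : AEDisjoint volume A' B' := by
    refine measure_mono_null (t := {a * x₁ + b * y₀}) ?_ (by simp)
    rintro _ ⟨⟨x, hx, rfl⟩, ⟨y, hy, hxy⟩⟩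
    have h1 := mul_le_mul_of_nonneg_left (hx₁' hx) ha.le
    have h2 := mul_le_mul_of_nonneg_left (hy₀' hy) hb.le
    simp only at hxy
    simp only [mem_singleton_iff]
    linarith
  calc ENNReal.ofReal a * volume A + ENNReal.ofReal b * volume B
      = volume (A' ∪ B') := by
        rw [measure_union₀ hmB.nullMeasurableSet hdisj, volume_image_mul_add ha,
          volume_image_mul_add hb]
    _ ≤ volume C := by
        refine measure_mono ?_
        rintro _ (⟨x, hx, rfl⟩ | ⟨y, hy, rfl⟩)
        · exact h x hx y₀ hy₀
        · simpa [add_comm] using h x₁ hx₁ y hy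

/-- The Brunn–Minkowski inequality on the line. -/
theorem MeasurableSet.volume_add_volume_le {a b : ℝ} (ha : 0 < a) (hb : 0 < b) {A B C : Set ℝ}
    (hA : MeasurableSet A) (hB : MeasurableSet B) (hA' : A.Nonempty) (hB' : B.Nonempty)
    (h : ∀ x ∈ A, ∀ y ∈ B, a * x + b * y ∈ C) :
    ENNReal.ofReal a * volume A + ENNReal.ofReal b * volume B ≤ volume C := by
  obtain ⟨x₀, hx₀⟩ := hA'
  obtain ⟨y₀, hy₀⟩ := hB'
  have e : ∀ {S : Set ℝ}, MeasurableSet S →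
      volume S = ⨆ K : {K : Set ℝ // K ⊆ S ∧ IsCompact K}, volume (K : Set ℝ) := by
    intro S hS
    rw [hS.measure_eq_iSup_isCompact, iSup_subtype]
    simp only [iSup_and]
  have : Nonempty {K : Set ℝ // K ⊆ A ∧ IsCompact K} := ⟨⟨∅, by simp⟩⟩
  have : Nonempty {K : Set ℝ // K ⊆ B ∧ IsCompact K} := ⟨⟨∅, by simp⟩⟩
  rw [e hA, e hB, ENNReal.mul_iSup, ENNReal.mul_iSup]
  refine ENNReal.iSup_add_iSup_le fun K M => ?_
  -- The approximating compact sets may be empty; inserting `x₀` and `y₀` prevents this.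
  refine le_trans ?_ (IsCompact.volume_add_volume_le ha hb (K.2.2.insert x₀) (M.2.2.insert y₀)
    (insert_nonempty _ _) (insert_nonempty _ _) (C := C) ?_)
  · gcongr <;> exact subset_insert _ _
  · intro x hx y hy
    refine h x ?_ y ?_
    · rcases hx with rfl | hx
      exacts [hx₀, K.2.1 hx]
    · rcases hy with rfl | hy
      exacts [hy₀, M.2.1 hy]

theorem lintegral_eq_lintegral_measure_lt_of_le_one {α : Type*} [MeasurableSpace α]
    (μ : Measure α) {f : α → ℝ≥0∞} (hf : Measurable f) (hf1 : ∀ x, f x ≤ 1) :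
    ∫⁻ x, f x ∂μ = ∫⁻ t in Ioo (0 : ℝ) 1, μ {x | ENNReal.ofReal t < f x} := by
  have h1 : ∀ x, ENNReal.ofReal (f x).toReal = f x := fun x =>
    ENNReal.ofReal_toReal (ne_top_of_le_ne_top ENNReal.one_ne_top (hf1 x))
  have h2 := lintegral_eq_lintegral_meas_lt μ (f := fun x => (f x).toReal)
    (ae_of_all _ fun x => ENNReal.toReal_nonneg) hf.ennreal_toReal.aemeasurable
  simp only [h1] at h2
  rw [h2, ← lintegral_indicator measurableSet_Ioi, ← lintegral_indicator measurableSet_Ioo]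
  congr 1 with t
  by_cases ht : t ∈ Ioo (0 : ℝ) 1
  · rw [indicator_of_mem (mem_Ioi.2 ht.1), indicator_of_mem ht]
    congr 1 with x
    simp only [mem_ofPred_eq]
    rw [ENNReal.ofReal_lt_iff_lt_toReal ht.1.le
      (ne_top_of_le_ne_top ENNReal.one_ne_top (hf1 x))]
  · rw [indicator_of_notMem ht]
    by_cases ht0 : t ∈ Ioi (0 : ℝ)
    · rw [indicator_of_mem ht0]
      have : {a | t < (f a).toReal} = ∅ := by
        refine eq_empty_of_forall_notMem fun x hx => ht ⟨ht0, lt_of_lt_of_le hx ?_⟩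
        simpa using ENNReal.toReal_mono ENNReal.one_ne_top (hf1 x)
      simp [this]
    · rw [indicator_of_notMem ht0]

/-- Brunn–Minkowski is applied to superlevel sets and integrated over the levels `t` in `(0, 1)`.
Normalising both suprema to `1` makes the superlevel sets of `f` and `g` nonempty at exactly the
same levels. -/
theorem lintegral_add_lintegral_le_of_iSup_eq_one {a b : ℝ} (ha : 0 < a) (hb : 0 < b)
    (hab : a + b = 1) {f g h : ℝ → ℝ≥0∞} (hf : Measurable f) (hg : Measurable g)
    (hh : Measurable h) (hf1 : ⨆ x, f x = 1) (hg1 : ⨆ x, g x = 1)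
    (hle : ∀ x y, f x ^ a * g y ^ b ≤ h (a * x + b * y)) :
    ENNReal.ofReal a * (∫⁻ x, f x) + ENNReal.ofReal b * (∫⁻ x, g x) ≤ ∫⁻ x, h x := by
  have hfle : ∀ x, f x ≤ 1 := fun x => hf1 ▸ le_iSup f x
  have hgle : ∀ x, g x ≤ 1 := fun x => hg1 ▸ le_iSup g x
  have hmeas : ∀ u : ℝ → ℝ≥0∞, Measurable u →
      Measurable fun t : ℝ => volume {x | ENNReal.ofReal t < u x} := fun u _ =>
    Antitone.measurable fun s t hst => measure_mono fun x hx =>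
      lt_of_le_of_lt (ENNReal.ofReal_le_ofReal hst) hx
  calc ENNReal.ofReal a * (∫⁻ x, f x) + ENNReal.ofReal b * (∫⁻ x, g x)
      = ∫⁻ t in Ioo (0 : ℝ) 1, (ENNReal.ofReal a * volume {x | ENNReal.ofReal t < f x} +
          ENNReal.ofReal b * volume {x | ENNReal.ofReal t < g x}) := by
        rw [lintegral_eq_lintegral_measure_lt_of_le_one _ hf hfle,
          lintegral_eq_lintegral_measure_lt_of_le_one _ hg hgle,
          lintegral_add_left ((hmeas f hf).const_mul _),
          lintegral_const_mul _ (hmeas f hf), lintegral_const_mul _ (hmeas g hg)]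
    _ ≤ ∫⁻ t in Ioo (0 : ℝ) 1, volume {x | ENNReal.ofReal t < min (h x) 1} := by
        refine setLIntegral_mono' measurableSet_Ioo fun t ht => ?_
        have ht1 : ENNReal.ofReal t < 1 := by simpa using ht.2
        have hne : ∀ u : ℝ → ℝ≥0∞, ⨆ x, u x = 1 → {x | ENNReal.ofReal t < u x}.Nonempty := by
          intro u hu
          exact lt_iSup_iff.1 (hu ▸ ht1)
        refine MeasurableSet.volume_add_volume_le ha hb (measurableSet_lt measurable_const hf)
          (measurableSet_lt measurable_const hg) (hne f hf1) (hne g hg1) fun x hx y hy => ?_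
        refine lt_min (lt_of_lt_of_le ?_ (hle x y)) ht1
        calc ENNReal.ofReal t = ENNReal.ofReal t ^ a * ENNReal.ofReal t ^ b := by
              rw [← ENNReal.rpow_add_of_nonneg _ _ ha.le hb.le, hab, ENNReal.rpow_one]
          _ < f x ^ a * g y ^ b :=
              ENNReal.mul_lt_mul (ENNReal.rpow_lt_rpow hx ha) (ENNReal.rpow_lt_rpow hy hb)
    _ = ∫⁻ x, min (h x) 1 :=
        (lintegral_eq_lintegral_measure_lt_of_le_one _ (hh.min measurable_const)
          fun x => min_le_right _ _).symm
    _ ≤ ∫⁻ x, h x := lintegral_mono fun x => min_le_left _ _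

/-- Dividing `f`, `g`, `h` by `M`, `N`, `M ^ a * N ^ b` reduces to suprema `1`; weighted AM–GM then
turns the sum into a product. -/
theorem lintegral_rpow_mul_lintegral_rpow_le_of_bounded {a b : ℝ} (ha : 0 < a) (hb : 0 < b)
    (hab : a + b = 1) {f g h : ℝ → ℝ≥0∞} (hf : Measurable f) (hg : Measurable g)
    (hh : Measurable h) (hf1 : ⨆ x, f x ≠ ∞) (hg1 : ⨆ x, g x ≠ ∞)
    (hle : ∀ x y, f x ^ a * g y ^ b ≤ h (a * x + b * y)) :
    (∫⁻ x, f x) ^ a * (∫⁻ x, g x) ^ b ≤ ∫⁻ x, h x := by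
  set M := ⨆ x, f x with hM
  set N := ⨆ x, g x with hN
  by_cases hM0 : M = 0
  · have : f = 0 := funext fun x => le_antisymm ((le_iSup f x).trans hM0.le) bot_le
    simp [this, ENNReal.zero_rpow_of_pos ha]
  by_cases hN0 : N = 0
  · have : g = 0 := funext fun x => le_antisymm ((le_iSup g x).trans hN0.le) bot_le
    simp [this, ENNReal.zero_rpow_of_pos hb]
  set c := M ^ a * N ^ b with hc
  have hMa0 : M ^ a ≠ 0 := by simp [ENNReal.rpow_eq_zero_iff, hM0, hf1]
  have hNb0 : N ^ b ≠ 0 := by simp [ENNReal.rpow_eq_zero_iff, hN0, hg1]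
  have hMat : M ^ a ≠ ∞ := ENNReal.rpow_ne_top_of_nonneg ha.le hf1
  have hNbt : N ^ b ≠ ∞ := ENNReal.rpow_ne_top_of_nonneg hb.le hg1
  have hc0 : c ≠ 0 := mul_ne_zero hMa0 hNb0
  have hct : c ≠ ∞ := ENNReal.mul_ne_top hMat hNbt
  have hcinv : c⁻¹ = (M⁻¹) ^ a * (N⁻¹) ^ b := by
    rw [ENNReal.inv_rpow, ENNReal.inv_rpow, hc, ENNReal.mul_inv (Or.inl hMa0) (Or.inl hMat)]
  have key := lintegral_add_lintegral_le_of_iSup_eq_one ha hb hab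
    (hf.const_mul M⁻¹) (hg.const_mul N⁻¹) (hh.const_mul c⁻¹)
    (by rw [← ENNReal.mul_iSup, ← hM, ENNReal.inv_mul_cancel hM0 hf1])
    (by rw [← ENNReal.mul_iSup, ← hN, ENNReal.inv_mul_cancel hN0 hg1])
    (fun x y => by
      rw [ENNReal.mul_rpow_of_nonneg _ _ ha.le, ENNReal.mul_rpow_of_nonneg _ _ hb.le,
        mul_mul_mul_comm, hcinv]
      gcongr
      exact hle x y)
  have key2 := (ENNReal.rpow_mul_rpow_le_add ha hb hab _ _).trans key
  rw [lintegral_const_mul _ hf, lintegral_const_mul _ hg, lintegral_const_mul _ hh,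
    ENNReal.mul_rpow_of_nonneg _ _ ha.le, ENNReal.mul_rpow_of_nonneg _ _ hb.le,
    mul_mul_mul_comm, ← hcinv] at key2
  exact (ENNReal.mul_le_mul_iff_right (ENNReal.inv_ne_zero.2 hct)
    (ENNReal.inv_ne_top.2 hc0)).1 key2

/-- The Prékopa–Leindler inequality on the line. -/
theorem satisfiesPrekopaLeindler_volume_real :
    SatisfiesPrekopaLeindler (volume : Measure ℝ) := by
  intro a b ha hb hab f g h hf hg hh hle
  by_cases hf0 : ∫⁻ x, f x = 0
  · simp [hf0, ENNReal.zero_rpow_of_pos ha]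
  by_cases hg0 : ∫⁻ x, g x = 0
  · simp [hg0, ENNReal.zero_rpow_of_pos hb]
  have hlim : ∀ u : ℝ → ℝ≥0∞, Measurable u →
      Tendsto (fun n : ℕ => ∫⁻ x, min (u x) n) atTop (𝓝 (∫⁻ x, u x)) := by
    intro u hu
    refine lintegral_tendsto_of_tendsto_of_monotone
      (fun n => (hu.min measurable_const).aemeasurable)
      (ae_of_all _ fun x m n hmn => min_le_min le_rfl (by exact_mod_cast hmn))
      (ae_of_all _ fun x => ?_)
    simpa using (tendsto_const_nhds (x := u x)).min ENNReal.tendsto_nat_nhds_top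
  have hb' : ∀ (u : ℝ → ℝ≥0∞) (n : ℕ), ⨆ x, min (u x) (n : ℝ≥0∞) ≠ ∞ := fun u n =>
    ne_top_of_le_ne_top (ENNReal.natCast_ne_top n) (iSup_le fun x => min_le_right _ _)
  -- The integrals are nonzero here, which excludes the limit form `0 * ∞`.
  refine le_of_tendsto (ENNReal.Tendsto.mul
    ((ENNReal.continuous_rpow_const.tendsto _).comp (hlim f hf)) (Or.inl ?_)
    ((ENNReal.continuous_rpow_const.tendsto _).comp (hlim g hg)) (Or.inl ?_))
    (Eventually.of_forall fun n => ?_)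
  · simp [ENNReal.rpow_eq_zero_iff, hf0, not_lt.2 ha.le]
  · simp [ENNReal.rpow_eq_zero_iff, hg0, not_lt.2 hb.le]
  · refine lintegral_rpow_mul_lintegral_rpow_le_of_bounded ha hb hab
      (hf.min measurable_const) (hg.min measurable_const) hh (hb' f n) (hb' g n) fun x y => ?_
    refine le_trans ?_ (hle x y)
    gcongr <;> exact min_le_left _ _

namespace SatisfiesPrekopaLeindler

variable {E F : Type*} [AddCommGroup E] [Module ℝ E] [MeasurableSpace E]
  [AddCommGroup F] [Module ℝ F] [MeasurableSpace F]

theorem withDensity {μ : Measure E} (hμ : SatisfiesPrekopaLeindler μ) {ρ : E → ℝ≥0∞}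
    (hρ : Measurable ρ) (hρ' : ∀ ⦃a b : ℝ⦄, 0 < a → 0 < b → a + b = 1 → ∀ x y,
      ρ x ^ a * ρ y ^ b ≤ ρ (a • x + b • y)) :
    SatisfiesPrekopaLeindler (μ.withDensity ρ) := by
  intro a b ha hb hab f g h hf hg hh hle
  rw [lintegral_withDensity_eq_lintegral_mul _ hρ hf,
    lintegral_withDensity_eq_lintegral_mul _ hρ hg,
    lintegral_withDensity_eq_lintegral_mul _ hρ hh]
  refine hμ ha hb hab (hρ.mul hf) (hρ.mul hg) (hρ.mul hh) fun x y => ?_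
  simp only [Pi.mul_apply]
  rw [ENNReal.mul_rpow_of_nonneg _ _ ha.le, ENNReal.mul_rpow_of_nonneg _ _ hb.le,
    mul_mul_mul_comm]
  exact mul_le_mul' (hρ' ha hb hab x y) (hle x y)

/-- The inequality on the fibres is precisely the pointwise hypothesis for the fibre integrals. -/
theorem prod {μ : Measure E} {ν : Measure F} [SFinite ν] (hμ : SatisfiesPrekopaLeindler μ)
    (hν : SatisfiesPrekopaLeindler ν) : SatisfiesPrekopaLeindler (μ.prod ν) := by
  intro a b ha hb hab f g h hf hg hh hle
  rw [lintegral_prod _ hf.aemeasurable, lintegral_prod _ hg.aemeasurable,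
    lintegral_prod _ hh.aemeasurable]
  refine hμ ha hb hab hf.lintegral_prod_right' hg.lintegral_prod_right'
    hh.lintegral_prod_right' fun x x' => ?_
  exact hν ha hb hab (hf.comp measurable_prodMk_left) (hg.comp measurable_prodMk_left)
    (hh.comp measurable_prodMk_left) fun y y' => hle (x, y) (x', y')

theorem map {μ : Measure E} (hμ : SatisfiesPrekopaLeindler μ) {T : E → F} (hT : Measurable T)
    (hT' : ∀ ⦃a b : ℝ⦄, a + b = 1 → ∀ x y, T (a • x + b • y) = a • T x + b • T y) :
    SatisfiesPrekopaLeindler (μ.map T) := by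
  intro a b ha hb hab f g h hf hg hh hle
  rw [lintegral_map hf hT, lintegral_map hg hT, lintegral_map hh hT]
  refine hμ ha hb hab (hf.comp hT) (hg.comp hT) (hh.comp hT) fun x y => ?_
  rw [hT' hab]
  exact hle _ _

theorem dirac (x₀ : E) : SatisfiesPrekopaLeindler (Measure.dirac x₀) := by
  intro a b ha hb hab f g h hf hg hh hle
  rw [lintegral_dirac' _ hf, lintegral_dirac' _ hg, lintegral_dirac' _ hh]
  simpa [← add_smul, hab] using hle x₀ x₀

theorem pi {n : ℕ} (μ : Fin n → Measure ℝ) [∀ i, SigmaFinite (μ i)]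
    (hμ : ∀ i, SatisfiesPrekopaLeindler (μ i)) : SatisfiesPrekopaLeindler (Measure.pi μ) := by
  induction n with
  | zero =>
    rw [Measure.pi_of_empty μ 0]
    exact dirac _
  | succ n ih =>
    have h := (measurePreserving_piFinSuccAbove μ 0).symm
    rw [← h.map_eq]
    refine ((hμ 0).prod (ih (fun i => μ ((0 : Fin (n + 1)).succAbove i))
      fun i => hμ _)).map h.measurable fun a b _ x y => ?_
    ext i
    refine Fin.cases ?_ (fun j => ?_) i <;>
      simp [MeasurableEquiv.piFinSuccAbove_symm_apply, Fin.insertNthEquiv]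

/-- For null-measurable convex sets, the Prékopa–Leindler inequality becomes log-concavity. -/
theorem measure_rpow_mul_measure_rpow_le {μ : Measure E} (hμ : SatisfiesPrekopaLeindler μ)
    {a b : ℝ} (ha : 0 < a) (hb : 0 < b) (hab : a + b = 1) {A B C : Set E}
    (hA : NullMeasurableSet A μ) (hB : NullMeasurableSet B μ)
    (h : ∀ x ∈ A, ∀ y ∈ B, a • x + b • y ∈ C) :
    μ A ^ a * μ B ^ b ≤ μ C := by
  obtain ⟨A', hA'A, hA', hAA⟩ := hA.exists_measurable_subset_ae_eq
  obtain ⟨B', hB'B, hB', hBB⟩ := hB.exists_measurable_subset_ae_eq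
  -- `A` and `B` are shrunk and `C` is enlarged, so the inclusion survives and `C` may be arbitrary.
  rw [← measure_congr hAA, ← measure_congr hBB, ← measure_toMeasurable C,
    ← lintegral_indicator_one hA', ← lintegral_indicator_one hB',
    ← lintegral_indicator_one (measurableSet_toMeasurable μ C)]
  refine hμ ha hb hab (measurable_one.indicator hA') (measurable_one.indicator hB')
    (measurable_one.indicator (measurableSet_toMeasurable μ C)) fun x y => ?_
  by_cases hx : x ∈ A'
  · by_cases hy : y ∈ B'
    · rw [indicator_of_mem hx, indicator_of_mem hy,
        indicator_of_mem (subset_toMeasurable _ _ (h x (hA'A hx) y (hB'B hy)))]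
      simp
    · simp [hy, ENNReal.zero_rpow_of_pos hb]
  · simp [hx, ENNReal.zero_rpow_of_pos ha]

end SatisfiesPrekopaLeindler

theorem satisfiesPrekopaLeindler_gaussianReal :
    SatisfiesPrekopaLeindler (gaussianReal 0 1) := by
  rw [gaussianReal_of_var_ne_zero 0 one_ne_zero]
  refine satisfiesPrekopaLeindler_volume_real.withDensity (measurable_gaussianPDF 0 1)
    fun a b ha hb hab x y => ?_
  simp only [gaussianPDF, gaussianPDFReal]
  have h2 : 0 < Real.sqrt (2 * Real.pi * ((1 : NNReal) : ℝ)) := by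
    apply Real.sqrt_pos.2; simp [Real.pi_pos]
  rw [ENNReal.ofReal_rpow_of_nonneg (by positivity) ha.le,
    ENNReal.ofReal_rpow_of_nonneg (by positivity) hb.le,
    ← ENNReal.ofReal_mul (by positivity)]
  refine ENNReal.ofReal_le_ofReal ?_
  rw [Real.mul_rpow (by positivity) (Real.exp_nonneg _),
    Real.mul_rpow (by positivity) (Real.exp_nonneg _), mul_mul_mul_comm,
    ← Real.rpow_add (by positivity), hab, Real.rpow_one, ← Real.exp_mul, ← Real.exp_mul,
    ← Real.exp_add]
  gcongr
  obtain rfl : b = 1 - a := by linarith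
  simp only [NNReal.coe_one, smul_eq_mul]
  -- `a * x ^ 2 + b * y ^ 2 - (a * x + b * y) ^ 2 = a * b * (x - y) ^ 2` when `a + b = 1`.
  nlinarith [mul_nonneg (mul_nonneg ha.le hb.le) (sq_nonneg (x - y))]

theorem satisfiesPrekopaLeindler_stdGaussian {E : Type*} [NormedAddCommGroup E]
    [InnerProductSpace ℝ E] [FiniteDimensional ℝ E] [MeasurableSpace E] [BorelSpace E] :
    SatisfiesPrekopaLeindler (stdGaussian E) := by
  refine (SatisfiesPrekopaLeindler.pi _ fun _ => satisfiesPrekopaLeindler_gaussianReal).map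
    (by fun_prop) fun a b _ x y => ?_
  simp only [Pi.add_apply, Pi.smul_apply, smul_eq_mul, add_smul, mul_smul,
    Finset.sum_add_distrib, Finset.smul_sum]

/-- Working with an affine image of the standard Gaussian avoids densities, which do not exist for
singular covariance. -/
theorem satisfiesPrekopaLeindler_multivariateGaussian {ι : Type*} [Fintype ι] [DecidableEq ι]
    (μ : EuclideanSpace ℝ ι) (S : Matrix ι ι ℝ) :
    SatisfiesPrekopaLeindler (multivariateGaussian μ S) := by
  refine satisfiesPrekopaLeindler_stdGaussian.map (by fun_prop) fun a b hab x y => ?_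
  have : μ = a • μ + b • μ := by rw [← add_smul, hab, one_smul]
  simp only [map_add, map_smul, smul_add]
  nth_rw 1 [this]
  abel

end PrekopaLeindler

/-! ### Null-measurability of convex sets for degenerate Gaussians. -/

section ConvexNullMeasurable

theorem MeasurableEmbedding.nullMeasurableSet_map {α β : Type*} [MeasurableSpace α]
    [MeasurableSpace β] {j : α → β} (hj : MeasurableEmbedding j) {μ : Measure α} {A : Set β}
    (hA : NullMeasurableSet (j ⁻¹' A) μ) : NullMeasurableSet A (μ.map j) := by
  obtain ⟨t, -, ht, hte⟩ := hA.exists_measurable_subset_ae_eq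
  refine ⟨j '' t, hj.measurableSet_image.2 ht, ?_⟩
  refine eventuallyEq_set.2 (hj.ae_map_iff.2 ?_)
  filter_upwards [eventuallyEq_set.1 hte] with x hx
  rw [hj.injective.mem_set_image, hx, mem_preimage]

/-- Convex sets are null-measurable for the affine image of an absolutely continuous measure, even
if that image is degenerate. -/
theorem Convex.nullMeasurableSet_map {E F : Type*}
    [NormedAddCommGroup E] [NormedSpace ℝ E] [FiniteDimensional ℝ E] [MeasurableSpace E]
    [BorelSpace E] [NormedAddCommGroup F] [NormedSpace ℝ F] [FiniteDimensional ℝ F]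
    [MeasurableSpace F] [BorelSpace F] {μ ν : Measure E} [ν.IsAddHaarMeasure] (hμ : μ ≪ ν)
    (L : E →ₗ[ℝ] F) (v : F) {A : Set F} (hA : Convex ℝ A) :
    NullMeasurableSet A (μ.map fun x => v + L x) := by
  -- On the range of `L` the image measure is absolutely continuous with respect to Haar measure,
  -- for which convex sets are null-measurable; `j` embeds this range as an affine subspace.
  set L₀ := L.rangeRestrict
  set j : LinearMap.range L → F := fun w => v + (w : F)
  have hj : MeasurableEmbedding j :=
    ((Homeomorph.addLeft v).isClosedEmbedding.comp
      (LinearMap.range L).closed_of_finiteDimensional.isClosedEmbedding_subtypeVal).measurableEmbedding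
  have hL₀ : Measurable L₀ := L₀.continuous_of_finiteDimensional.measurable
  have hmap : (μ.map fun x => v + L x) = (μ.map L₀).map j := by
    rw [Measure.map_map hj.measurable hL₀]
    rfl
  rw [hmap]
  refine hj.nullMeasurableSet_map ?_
  -- The factor `c` may be infinite; only absolute continuity is used.
  obtain ⟨c, -, hc⟩ := L₀.exists_map_addHaar_eq_smul_addHaar ν
    (Measure.addHaar : Measure (LinearMap.range L)) L.surjective_rangeRestrict
  have hac : μ.map L₀ ≪ Measure.addHaar := by
    refine (hμ.map hL₀).trans ?_
    rw [hc]
    exact Measure.smul_absolutelyContinuous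
  refine NullMeasurableSet.mono_ac (Convex.nullMeasurableSet _ ?_) hac
  intro x hx y hy a b ha hb hab
  have := hA hx hy ha hb hab
  have hv : a • v + b • v = v := by rw [← add_smul, hab, one_smul]
  have e : a • (v + (x : F)) + b • (v + (y : F)) = v + (a • (x : F) + b • (y : F)) := by
    nth_rw 3 [← hv]
    simp only [smul_add]
    abel
  rw [e] at this
  exact this

theorem MeasureTheory.Measure.AbsolutelyContinuous.pi_fin {n : ℕ} {μ ν : Fin n → Measure ℝ}
    [∀ i, SigmaFinite (μ i)] [∀ i, SigmaFinite (ν i)] (h : ∀ i, μ i ≪ ν i) :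
    Measure.pi μ ≪ Measure.pi ν := by
  induction n with
  | zero =>
    rw [Measure.pi_of_empty μ 0, Measure.pi_of_empty ν 0]
  | succ n ih =>
    have h₁ := (measurePreserving_piFinSuccAbove μ 0).symm
    have h₂ := (measurePreserving_piFinSuccAbove ν 0).symm
    rw [← h₁.map_eq, ← h₂.map_eq]
    exact ((h 0).prod (ih fun i => h _)).map h₁.measurable

theorem Convex.nullMeasurableSet_map_stdGaussian {E F : Type*} [NormedAddCommGroup E]
    [InnerProductSpace ℝ E] [FiniteDimensional ℝ E] [MeasurableSpace E] [BorelSpace E]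
    [NormedAddCommGroup F] [NormedSpace ℝ F] [FiniteDimensional ℝ F] [MeasurableSpace F]
    [BorelSpace F] (T : E →L[ℝ] F) (v : F) {A : Set F} (hA : Convex ℝ A) :
    NullMeasurableSet A ((stdGaussian E).map fun x => v + T x) := by
  have hac : (Measure.pi fun _ : Fin (Module.finrank ℝ E) => gaussianReal 0 1) ≪ volume := by
    rw [volume_pi]
    exact Measure.AbsolutelyContinuous.pi_fin fun _ =>
      gaussianReal_absolutelyContinuous 0 one_ne_zero
  rw [stdGaussian, Measure.map_map (by fun_prop) (by fun_prop)]
  exact hA.nullMeasurableSet_map hac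
    (T.toLinearMap ∘ₗ Fintype.linearCombination ℝ (stdOrthonormalBasis ℝ E)) v

theorem Convex.nullMeasurableSet_multivariateGaussian {ι : Type*} [Fintype ι] [DecidableEq ι]
    (μ : EuclideanSpace ℝ ι) (S : Matrix ι ι ℝ) {A : Set (EuclideanSpace ℝ ι)}
    (hA : Convex ℝ A) : NullMeasurableSet A (multivariateGaussian μ S) :=
  hA.nullMeasurableSet_map_stdGaussian _ μ

end ConvexNullMeasurable

/-! ### Log-concavity under truncation. -/

section TruncatedGaussian

variable {m : ℕ} (μ : EuclideanSpace ℝ (Fin m)) (S : Matrix (Fin m) (Fin m) ℝ)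
  {Ξ A B C : Set (EuclideanSpace ℝ (Fin m))}

theorem Convex.nullMeasurableSet_truncatedGaussian (hA : Convex ℝ A) :
    NullMeasurableSet A (truncatedGaussian μ S Ξ) :=
  (hA.nullMeasurableSet_multivariateGaussian μ S).mono_ac (cond_absolutelyContinuous ..)

/-- A Gaussian distribution truncated to a convex set is log-concave on convex sets. -/
theorem truncatedGaussian_rpow_mul_rpow_le (hΞ : Convex ℝ Ξ) (hΞm : MeasurableSet Ξ) {a b : ℝ}
    (ha : 0 < a) (hb : 0 < b) (hab : a + b = 1) (hA : Convex ℝ A) (hB : Convex ℝ B)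
    (h : ∀ x ∈ A, ∀ y ∈ B, a • x + b • y ∈ C) :
    truncatedGaussian μ S Ξ A ^ a * truncatedGaussian μ S Ξ B ^ b ≤
      truncatedGaussian μ S Ξ C := by
  simp only [truncatedGaussian, cond_apply hΞm]
  set G := multivariateGaussian μ S
  -- The normalising factors `(G Ξ)⁻¹` combine with total exponent `a + b = 1` and cancel.
  rw [ENNReal.mul_rpow_of_nonneg _ _ ha.le, ENNReal.mul_rpow_of_nonneg _ _ hb.le,
    mul_mul_mul_comm, ← ENNReal.rpow_add_of_nonneg _ _ ha.le hb.le, hab, ENNReal.rpow_one]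
  gcongr
  exact (satisfiesPrekopaLeindler_multivariateGaussian μ S).measure_rpow_mul_measure_rpow_le
    ha hb hab ((hΞ.inter hA).nullMeasurableSet_multivariateGaussian μ S)
    ((hΞ.inter hB).nullMeasurableSet_multivariateGaussian μ S)
    fun x hx y hy => ⟨hΞ hx.1 hy.1 ha.le hb.le hab, h x hx.2 y hy.2⟩

end TruncatedGaussian

/-! ### Linearity of the state equation and convexity of the feasible set. -/

section Poisson

variable {d : ℕ} {D : Set (EuclideanSpace ℝ (Fin d))}

namespace IsTestFunction

variable {φ ψ : EuclideanSpace ℝ (Fin d) → ℝ}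

theorem smul_add_smul (hφ : IsTestFunction D φ) (hψ : IsTestFunction D ψ) (a b : ℝ) :
    IsTestFunction D (a • φ + b • ψ) where
  contDiff := (hφ.contDiff.const_smul a).add (hψ.contDiff.const_smul b)
  hasCompactSupport :=
    (hφ.hasCompactSupport.smul_left (f := fun _ => a)).add
      (hψ.hasCompactSupport.smul_left (f := fun _ => b))
  tsupport_subset := (tsupport_add _ _).trans (union_subset
    ((tsupport_smul_subset_right (fun _ => a) φ).trans hφ.tsupport_subset)
    ((tsupport_smul_subset_right (fun _ => b) ψ).trans hψ.tsupport_subset))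

theorem differentiable (hφ : IsTestFunction D φ) : Differentiable ℝ φ :=
  hφ.contDiff.differentiable (by simp)

theorem gradient_smul_add_smul (hφ : IsTestFunction D φ) (hψ : IsTestFunction D ψ) (a b : ℝ)
    (x : EuclideanSpace ℝ (Fin d)) : ∇ (a • φ + b • ψ) x = a • ∇ φ x + b • ∇ ψ x := by
  simp only [gradient]
  rw [fderiv_add ((hφ.differentiable x).const_smul a) ((hψ.differentiable x).const_smul b),
    fderiv_const_smul (hφ.differentiable x), fderiv_const_smul (hψ.differentiable x)]
  simp

theorem continuous_gradient (hφ : IsTestFunction D φ) : Continuous (∇ φ) :=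
  (InnerProductSpace.toDual ℝ _).symm.continuous.comp (hφ.contDiff.continuous_fderiv (by simp))

theorem memLp (hφ : IsTestFunction D φ) : MemLp φ 2 (volume.restrict D) :=
  hφ.contDiff.continuous.memLp_of_hasCompactSupport hφ.hasCompactSupport

theorem memLp_gradient (hφ : IsTestFunction D φ) : MemLp (∇ φ) 2 (volume.restrict D) :=
  hφ.continuous_gradient.memLp_of_hasCompactSupport
    ((hφ.hasCompactSupport.fderiv ℝ).comp_left (map_zero _))

end IsTestFunction

theorem MeasureTheory.MemLp.integrable_inner_of_two {α E : Type*} [MeasurableSpace α]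
    [NormedAddCommGroup E] [InnerProductSpace ℝ E] {μ : Measure α} {f g : α → E}
    (hf : MemLp f 2 μ) (hg : MemLp g 2 μ) : Integrable (fun x => inner ℝ (f x) (g x)) μ := by
  refine (L2.integrable_inner (𝕜 := ℝ) hf.toLp hg.toLp).congr ?_
  filter_upwards [hf.coeFn_toLp, hg.coeFn_toLp] with x h1 h2
  rw [h1, h2]

theorem tendsto_eLpNorm_smul_add_smul {α E : Type*} [MeasurableSpace α]
    [NormedAddCommGroup E] [NormedSpace ℝ E] {μ : Measure α} {u v : ℕ → α → E}
    (hu : ∀ n, AEStronglyMeasurable (u n) μ) (hv : ∀ n, AEStronglyMeasurable (v n) μ)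
    (hu0 : Tendsto (fun n => eLpNorm (u n) 2 μ) atTop (𝓝 0))
    (hv0 : Tendsto (fun n => eLpNorm (v n) 2 μ) atTop (𝓝 0)) (a b : ℝ) :
    Tendsto (fun n => eLpNorm (a • u n + b • v n) 2 μ) atTop (𝓝 0) := by
  have h := (ENNReal.Tendsto.const_mul (a := ‖a‖ₑ) hu0 (Or.inr enorm_ne_top)).add
    (ENNReal.Tendsto.const_mul (a := ‖b‖ₑ) hv0 (Or.inr enorm_ne_top))
  simp only [mul_zero, add_zero] at h
  refine tendsto_of_tendsto_of_tendsto_of_le_of_le tendsto_const_nhds h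
    (fun _ => bot_le) fun n => ?_
  refine (eLpNorm_add_le ((hu n).const_smul a) ((hv n).const_smul b) one_le_two).trans ?_
  rw [eLpNorm_const_smul, eLpNorm_const_smul]

theorem HasH10Gradient.smul_add_smul {y₁ y₂ : EuclideanSpace ℝ (Fin d) → ℝ}
    {G₁ G₂ : EuclideanSpace ℝ (Fin d) → EuclideanSpace ℝ (Fin d)}
    (h₁ : HasH10Gradient D y₁ G₁) (h₂ : HasH10Gradient D y₂ G₂) (a b : ℝ) :
    HasH10Gradient D (a • y₁ + b • y₂) (a • G₁ + b • G₂) where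
  memLp := (h₁.memLp.const_smul a).add (h₂.memLp.const_smul b)
  memLp_gradient := (h₁.memLp_gradient.const_smul a).add (h₂.memLp_gradient.const_smul b)
  exists_approx := by
    obtain ⟨φ, hφ, hφy, hφG⟩ := h₁.exists_approx
    obtain ⟨ψ, hψ, hψy, hψG⟩ := h₂.exists_approx
    refine ⟨fun n => a • φ n + b • ψ n, fun n => (hφ n).smul_add_smul (hψ n) a b, ?_, ?_⟩
    · refine (tendsto_eLpNorm_smul_add_smul (fun n => ((hφ n).memLp.sub h₁.memLp).1)
        (fun n => ((hψ n).memLp.sub h₂.memLp).1) hφy hψy a b).congr fun n => ?_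
      congr 1 with x
      simp only [Pi.add_apply, Pi.smul_apply, Pi.sub_apply, smul_eq_mul]
      ring
    · refine (tendsto_eLpNorm_smul_add_smul
        (fun n => ((hφ n).memLp_gradient.sub h₁.memLp_gradient).1)
        (fun n => ((hψ n).memLp_gradient.sub h₂.memLp_gradient).1) hφG hψG a b).congr
        fun n => ?_
      congr 1
      funext x
      rw [(hφ n).gradient_smul_add_smul (hψ n)]
      simp only [Pi.add_apply, Pi.smul_apply, Pi.sub_apply, smul_sub]
      abel

/-- The Poisson problem is linear. -/
theorem IsPoissonSolution.smul_add_smul {r₁ r₂ : L2 D} {y₁ y₂ : EuclideanSpace ℝ (Fin d) → ℝ}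
    (h₁ : IsPoissonSolution D r₁ y₁) (h₂ : IsPoissonSolution D r₂ y₂) (a b : ℝ) :
    IsPoissonSolution D (a • r₁ + b • r₂) (a • y₁ + b • y₂) where
  continuousOn := (h₁.continuousOn.const_smul a).add (h₂.continuousOn.const_smul b)
  eq_zero_of_mem_frontier x hx := by
    simp [h₁.eq_zero_of_mem_frontier x hx, h₂.eq_zero_of_mem_frontier x hx]
  weak_eq := by
    obtain ⟨G₁, hG₁, hw₁⟩ := h₁.weak_eq
    obtain ⟨G₂, hG₂, hw₂⟩ := h₂.weak_eq
    refine ⟨a • G₁ + b • G₂, hG₁.smul_add_smul hG₂ a b, fun φ hφ => ?_⟩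
    have i₁ := hG₁.memLp_gradient.integrable_inner_of_two hφ.memLp_gradient
    have i₂ := hG₂.memLp_gradient.integrable_inner_of_two hφ.memLp_gradient
    have j₁ : Integrable (fun x => r₁ x * φ x) (volume.restrict D) :=
      (Lp.memLp r₁).integrable_mul hφ.memLp
    have j₂ : Integrable (fun x => r₂ x * φ x) (volume.restrict D) :=
      (Lp.memLp r₂).integrable_mul hφ.memLp
    calc ∫ x in D, inner ℝ ((a • G₁ + b • G₂) x) (∇ φ x)
        = ∫ x in D, (a * inner ℝ (G₁ x) (∇ φ x) + b * inner ℝ (G₂ x) (∇ φ x)) := by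
          simp only [Pi.add_apply, Pi.smul_apply, inner_add_left, real_inner_smul_left]
      _ = ∫ x in D, (a * (r₁ x * φ x) + b * (r₂ x * φ x)) := by
          rw [integral_add (i₁.const_mul a) (i₂.const_mul b), integral_const_mul,
            integral_const_mul, hw₁ φ hφ, hw₂ φ hφ, ← integral_const_mul, ← integral_const_mul,
            integral_add (j₁.const_mul a) (j₂.const_mul b)]
      _ = ∫ x in D, (a • r₁ + b • r₂ : L2 D) x * φ x := by
          refine integral_congr_ae ?_
          filter_upwards [Lp.coeFn_add (a • r₁) (b • r₂), Lp.coeFn_smul a r₁,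
            Lp.coeFn_smul b r₂] with x e e₁ e₂
          rw [e, Pi.add_apply, e₁, e₂, Pi.smul_apply, Pi.smul_apply, smul_eq_mul, smul_eq_mul]
          ring

theorem smul_add_sourceTerm_add_smul_add_sourceTerm {m : ℕ} (f₀ : L2 D) (φ : Fin m → L2 D)
    {a b : ℝ} (hab : a + b = 1) (u₁ u₂ : L2 D) (z₁ z₂ : EuclideanSpace ℝ (Fin m)) :
    a • (u₁ + sourceTerm f₀ φ z₁) + b • (u₂ + sourceTerm f₀ φ z₂) =
      (a • u₁ + b • u₂) + sourceTerm f₀ φ (a • z₁ + b • z₂) := by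
  have hf : a • f₀ + b • f₀ = f₀ := by rw [← add_smul, hab, one_smul]
  simp only [sourceTerm, smul_add, Finset.smul_sum, PiLp.add_apply, PiLp.smul_apply, add_smul,
    Finset.sum_add_distrib, smul_eq_mul, mul_smul]
  nth_rw 3 [← hf]
  abel

/-- The outcomes `z` of the random parameter for which the control `u` leads to a state that
satisfies the state constraint. -/
def safeOutcomes {m : ℕ} (f₀ : L2 D) (φ : Fin m → L2 D) (α : ℝ) (u : L2 D) :
    Set (EuclideanSpace ℝ (Fin m)) :=
  {z | ∃ y, IsPoissonSolution D (u + sourceTerm f₀ φ z) y ∧ ∀ x ∈ D, y x ≤ α}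

theorem smul_add_smul_mem_safeOutcomes {m : ℕ} {f₀ : L2 D} {φ : Fin m → L2 D} {α : ℝ}
    {u₁ u₂ : L2 D} {z₁ z₂ : EuclideanSpace ℝ (Fin m)} (h₁ : z₁ ∈ safeOutcomes f₀ φ α u₁)
    (h₂ : z₂ ∈ safeOutcomes f₀ φ α u₂) {a b : ℝ} (ha : 0 ≤ a) (hb : 0 ≤ b) (hab : a + b = 1) :
    a • z₁ + b • z₂ ∈ safeOutcomes f₀ φ α (a • u₁ + b • u₂) := by
  obtain ⟨y₁, hy₁, hα₁⟩ := h₁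
  obtain ⟨y₂, hy₂, hα₂⟩ := h₂
  refine ⟨a • y₁ + b • y₂, ?_, fun x hx => ?_⟩
  · rw [← smul_add_sourceTerm_add_smul_add_sourceTerm f₀ φ hab]
    exact hy₁.smul_add_smul hy₂ a b
  · calc a * y₁ x + b * y₂ x ≤ a * α + b * α := by
          gcongr
          exacts [hα₁ x hx, hα₂ x hx]
      _ = α := by rw [← add_mul, hab, one_mul]

theorem convex_safeOutcomes {m : ℕ} (f₀ : L2 D) (φ : Fin m → L2 D) (α : ℝ) (u : L2 D) :
    Convex ℝ (safeOutcomes f₀ φ α u) := by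
  intro z₁ h₁ z₂ h₂ a b ha hb hab
  have h := smul_add_smul_mem_safeOutcomes h₁ h₂ ha hb hab
  rwa [← add_smul, hab, one_smul] at h

theorem convex_feasibleSet {m : ℕ} (f₀ : L2 D) (φ : Fin m → L2 D) (α p : ℝ)
    {Ω : Type*} [MeasurableSpace Ω] (P : Measure Ω) [IsProbabilityMeasure P]
    (ξ : Ω → EuclideanSpace ℝ (Fin m)) (μ : EuclideanSpace ℝ (Fin m))
    (S : Matrix (Fin m) (Fin m) ℝ) {Ξ : Set (EuclideanSpace ℝ (Fin m))} (hΞ : Convex ℝ Ξ)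
    (hΞm : MeasurableSet Ξ) (hξ : HasLaw ξ (truncatedGaussian μ S Ξ) P) :
    Convex ℝ (feasibleSet D f₀ φ α p P ξ) := by
  refine convex_iff_forall_pos.2 fun u₁ hu₁ u₂ hu₂ a b ha hb hab => ?_
  have hlaw : ∀ u, P (ξ ⁻¹' safeOutcomes f₀ φ α u) =
      truncatedGaussian μ S Ξ (safeOutcomes f₀ φ α u) := by
    intro u
    rw [← hξ.map_eq, Measure.map_apply₀ hξ.aemeasurable]
    rw [hξ.map_eq]
    exact (convex_safeOutcomes f₀ φ α u).nullMeasurableSet_truncatedGaussian μ S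
  have hle : ∀ (u : L2 D) (y : Ω → EuclideanSpace ℝ (Fin d) → ℝ),
      (∀ᵐ ω ∂P, IsPoissonSolution D (u + sourceTerm f₀ φ (ξ ω)) (y ω)) →
      p ≤ P.real {ω | ∀ x ∈ D, y ω x ≤ α} →
      ENNReal.ofReal p ≤ truncatedGaussian μ S Ξ (safeOutcomes f₀ φ α u) := by
    intro u y hy hp
    rw [← hlaw]
    refine (ENNReal.ofReal_le_of_le_toReal hp).trans (measure_mono_ae ?_)
    filter_upwards [hy] with ω hω hωα
    exact ⟨y ω, hω, hωα⟩
  obtain ⟨y₁, hy₁, hp₁⟩ := hu₁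
  obtain ⟨y₂, hy₂, hp₂⟩ := hu₂
  set u := a • u₁ + b • u₂
  have hsafe : ENNReal.ofReal p ≤ P (ξ ⁻¹' safeOutcomes f₀ φ α u) := by
    rw [hlaw]
    calc ENNReal.ofReal p = ENNReal.ofReal p ^ a * ENNReal.ofReal p ^ b := by
          rw [← ENNReal.rpow_add_of_nonneg _ _ ha.le hb.le, hab, ENNReal.rpow_one]
      _ ≤ truncatedGaussian μ S Ξ (safeOutcomes f₀ φ α u₁) ^ a *
            truncatedGaussian μ S Ξ (safeOutcomes f₀ φ α u₂) ^ b := by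
          gcongr
          exacts [hle u₁ y₁ hy₁ hp₁, hle u₂ y₂ hy₂ hp₂]
      _ ≤ truncatedGaussian μ S Ξ (safeOutcomes f₀ φ α u) :=
          truncatedGaussian_rpow_mul_rpow_le μ S hΞ hΞm ha hb hab
            (convex_safeOutcomes f₀ φ α u₁) (convex_safeOutcomes f₀ φ α u₂)
            fun z₁ h₁ z₂ h₂ => smul_add_smul_mem_safeOutcomes h₁ h₂ ha.le hb.le hab
  -- The state for `u` must be a solution almost surely, also at unsafe outcomes. There `a • y₁ ω +
  -- b • y₂ ω` serves, and at safe outcomes a solution below `α` is chosen; neither existence nor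
  -- uniqueness theory enters.
  have hex : ∀ ω, ∃ y : EuclideanSpace ℝ (Fin d) → ℝ,
      (IsPoissonSolution D (u₁ + sourceTerm f₀ φ (ξ ω)) (y₁ ω) →
        IsPoissonSolution D (u₂ + sourceTerm f₀ φ (ξ ω)) (y₂ ω) →
        IsPoissonSolution D (u + sourceTerm f₀ φ (ξ ω)) y) ∧
      (ξ ω ∈ safeOutcomes f₀ φ α u → ∀ x ∈ D, y x ≤ α) := by
    intro ω
    by_cases hω : ξ ω ∈ safeOutcomes f₀ φ α u
    · obtain ⟨y, hy, hyα⟩ := hω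
      exact ⟨y, fun _ _ => hy, fun _ => hyα⟩
    · refine ⟨a • y₁ ω + b • y₂ ω, fun h₁ h₂ => ?_, fun h => absurd h hω⟩
      have h := h₁.smul_add_smul h₂ a b
      rwa [smul_add_sourceTerm_add_smul_add_sourceTerm f₀ φ hab, ← add_smul, hab, one_smul] at h
  choose y hy hyα using hex
  refine ⟨y, ?_, ?_⟩
  · filter_upwards [hy₁, hy₂] with ω h₁ h₂ using hy ω h₁ h₂
  · exact (ENNReal.ofReal_le_iff_le_toReal (measure_ne_top _ _)).1
      (hsafe.trans (measure_mono fun ω hω => hyα ω hω))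

end Poisson

theorem mainTheorem3 {d m : ℕ} (hd : 1 ≤ d) (hd' : d ≤ 3)
    (D : Set (EuclideanSpace ℝ (Fin d))) (hDo : IsOpen D) (hDb : Bornology.IsBounded D)
    (hDS : IsClassS D) (f₀ : L2 D) (φ : Fin m → L2 D)
    (F : L2 D → ℝ) (hF : ConvexOn ℝ univ F) (hF' : Differentiable ℝ F)
    (α p : ℝ) (hp : p ∈ Ioc (0 : ℝ) 1)
    {Ω : Type*} [MeasurableSpace Ω] (P : Measure Ω) [IsProbabilityMeasure P]
    (ξ : Ω → EuclideanSpace ℝ (Fin m))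
    (hξ : (∃ (μ : EuclideanSpace ℝ (Fin m)) (S : Matrix (Fin m) (Fin m) ℝ), S.PosSemidef ∧
        HasLaw ξ (multivariateGaussian μ S) P) ∨
      (∃ (μ : EuclideanSpace ℝ (Fin m)) (S : Matrix (Fin m) (Fin m) ℝ)
        (s : EuclideanSpace ℝ (Fin m) → ℝ), S.PosSemidef ∧ ConvexOn ℝ univ s ∧
        HasLaw ξ (truncatedGaussian μ S {z | s z ≤ 0}) P)) :
    IsConvexProblem F (feasibleSet D f₀ φ α p P ξ) := by
  refine ⟨hF, ?_⟩
  obtain ⟨μ, S, -, h⟩ | ⟨μ, S, s, -, hs, h⟩ := hξ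
  -- The untruncated Gaussian is the truncation to the whole space.
  · refine convex_feasibleSet f₀ φ α p P ξ μ S convex_univ MeasurableSet.univ ?_
    rwa [truncatedGaussian, cond_univ]
  -- Finite convex functions on `ℝ^m` are continuous, so `Ξ` is measurable.
  · have hsc : Continuous s := by
      simpa [continuousOn_univ] using hs.continuousOn isOpen_univ
    refine convex_feasibleSet f₀ φ α p P ξ μ S ?_ (measurableSet_le hsc.measurable
      measurable_const) h
    simpa using hs.convex_le 0
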